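/- Let $(\Omega,\mathcal F)$ be a measurable space with a measurable flow $(\theta_s)_{s\in\mathbb R^d}$ (i.e. $(\omega,s)\mapsto\theta_s\omega$ is measurable, $\theta_0=\mathrm{id}$, $\theta_s\circ\theta_t=\theta_{s+t}$), and let $\mathbb P$ be a probability measure on $\Omega$ that is invariant under every $\theta_s$. Let $\Phi,\Psi$ be stationary random measures on $\mathbb R^d$, that is, measurable maps from $\Omega$ to the locally finite Borel measures on $\mathbb R^d$ with $\Phi_{\theta_s\omega}(B)=\Phi_\omega(B+s)$ and $\Psi_{\theta_s\omega}(B)=\Psi_\omega(B+s)$ for all $s$, $\omega$ and Borel $B$. Assume that $\Phi$ and $\Psi$ are almost surely non-zero and have finite intensities, i.e. $\mathbb E[\Phi(B)]=\lambda_\Phi\,\mathcal L_d(B)$ and $\mathbb E[\Psi(B)]=\lambda_\Psi\,\mathcal L_d(B)$ for all Borel $B$, with $\lambda_\Phi,\lambda_\Psi<\infty$. For locally finite measures $\varphi,\psi$ on $\mathbb R^d$, a constrained density is a measurable function $f:\mathbb R^d\times\mathbb R^d\to[0,1]$ with $\int f(x,\xi)\,\psi(d\xi)\le 1$ for all $x$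 and $\int f(x,\xi)\,\varphi(dx)\le 1$ for all $\xi$. A point $x_0$ desires $\xi_0$ if $f(x_0,\xi_0)<1$ and either $\int f(x_0,\xi)\,\psi(d\xi)\neq1$ or there is $\xi_1\in\mathbb R^d$ with $|x_0-\xi_1|>|x_0-\xi_0|$ and $f(x_0,\xi_1)>0$; symmetrically, $\xi_0$ desires $x_0$ if $f(x_0,\xi_0)<1$ and either $\int f(x,\xi_0)\,\varphi(dx)\ne1$ or there is $x_1\in\mathbb R^d$ with $|x_1-\xi_0|>|x_0-\xi_0|$ and $f(x_1,\xi_0)>0$. The density $f$ is stable if there is no $(x_0,\xi_0)\in\mathbb R^d\times\mathbb R^d$ such that $x_0$ and $\xi_0$ desire each other. The points of the support of $\varphi$ (resp. $\psi$) are called sites (resp. centers); the territory of a site $x$ is $\{\xi\in\mathbb R^d: f(x,\xi)>0\}$ and the territory of a center $\xi$ is $\{x\in\mathbb R^d: f(x,\xi)>0\}$ (the same notation is used for arbitrary points of $\mathbb R^d$). Let $F=F_\omega(x,\xi)$ be jointly measurable in $(\omega,x,\xi)$ and flow-adapted, i.e. $F_{\theta_s\omega}(x,\xi)=F_\omega(x+s,\xi+s)$,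 and suppose that almost surely $F_\omega$ is a stable constrained density for $(\Phi_\omega,\Psi_\omega)$. Then, almost surely: (i) $\Phi_\omega$-almost all sites and $\Psi_\omega$-almost all centers have bounded territories; (ii) for every bounded set $B\subset\mathbb R^d$, the union $\bigcup_{x\in B}\{\xi: F_\omega(x,\xi)>0\}$ has finite $\Psi_\omega$-measure and the union $\bigcup_{\xi\in B}\{x: F_\omega(x,\xi)>0\}$ has finite $\Phi_\omega$-measure (outer measure, when the set is not measurable). In particular, the union of the territories of the sites (resp. centers) in a bounded set has finite $\Psi_\omega$-measure (resp. finite $\Phi_\omega$-measure). -/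

import Mathlib

open MeasureTheory
open scoped ENNReal NNReal

namespace StableDensity

/-- `ℝ^d` with its Euclidean distance, Borel `σ`-field and Lebesgue measure. -/
abbrev Space (d : ℕ) : Type := EuclideanSpace ℝ (Fin d)

section Random

variable {d : ℕ} {Ω : Type*} [MeasurableSpace Ω]

/-- A measurable flow `(θ_s)`, `s ∈ ℝ^d`, on the measurable space `Ω`. -/
structure IsMeasurableFlow (θ : Space d → Ω → Ω) : Prop where
  measurable : Measurable fun p : Ω × Space d => θ p.2 p.1
  zero : ∀ ω, θ 0 ω = ω
  comp : ∀ s t ω, θ s (θ t ω) = θ (s + t) ω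

/-- The measure `P` on `Ω` is invariant under every `θ_s`. -/
def IsStationary (θ : Space d → Ω → Ω) (P : Measure Ω) : Prop :=
  ∀ s, MeasurePreserving (θ s) P P

/-- The shift `(θ_s φ)(B) = φ(B + s)` of a measure on `ℝ^d`. -/
noncomputable def shiftMeasure (s : Space d) (φ : Measure (Space d)) : Measure (Space d) :=
  φ.map (fun y => y - s)

/-- `(P, Φ)` is a stationary random measure with respect to the flow `θ`: `P` is stationary, and
`Φ` is a measurable flow-adapted map into the locally finite measures on `ℝ^d` (the `σ`-field on
measures being the one generated by the evaluations at Borel sets). -/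
structure IsStationaryRandomMeasure (θ : Space d → Ω → Ω) (P : Measure Ω)
    (Φ : Ω → Measure (Space d)) : Prop where
  stationary : IsStationary θ P
  measurable : Measurable Φ
  locallyFinite : ∀ ω, IsLocallyFiniteMeasure (Φ ω)
  flowAdapted : ∀ s ω, Φ (θ s ω) = shiftMeasure s (Φ ω)

/-- `lam` is the intensity of `(P, Φ)`: `E[Φ(B)] = lam * Leb(B)` for all Borel sets `B`. -/
def HasIntensity (P : Measure Ω) (Φ : Ω → Measure (Space d)) (lam : ℝ≥0∞) : Prop :=
  ∀ B : Set (Space d), MeasurableSet B → ∫⁻ ω, Φ ω B ∂P = lam * volume B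

/-- A (jointly) measurable random function of a site and a center such that
`F_{θ_s ω}(x, ξ) = F_ω(x + s, ξ + s)`. -/
structure IsFlowAdaptedFunction (θ : Space d → Ω → Ω) (F : Ω → Space d → Space d → ℝ) : Prop where
  measurable : Measurable fun p : Ω × Space d × Space d => F p.1 p.2.1 p.2.2
  flowAdapted : ∀ s ω x ξ, F (θ s ω) x ξ = F ω (x + s) (ξ + s)

end Random

section Deterministic

variable {d : ℕ}

/-- `f` is a constrained density for `(φ, ψ)`: a measurable function with values in `[0, 1]`
whose two marginal integrals are at most `1` at every point. -/
structure IsConstrainedDensity (φ ψ : Measure (Space d)) (f : Space d → Space d → ℝ) : Prop where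
  measurable : Measurable fun p : Space d × Space d => f p.1 p.2
  nonneg : ∀ x ξ, 0 ≤ f x ξ
  le_one : ∀ x ξ, f x ξ ≤ 1
  site_le : ∀ x, ∫⁻ ξ, ENNReal.ofReal (f x ξ) ∂ψ ≤ 1
  center_le : ∀ ξ, ∫⁻ x, ENNReal.ofReal (f x ξ) ∂φ ≤ 1

/-- The site `x` is `f`-exhausted. -/
def Exhausted (ψ : Measure (Space d)) (f : Space d → Space d → ℝ) (x : Space d) : Prop :=
  ∫⁻ ξ, ENNReal.ofReal (f x ξ) ∂ψ = 1

/-- The center `ξ` is `f`-sated. -/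
def Sated (φ : Measure (Space d)) (f : Space d → Space d → ℝ) (ξ : Space d) : Prop :=
  ∫⁻ x, ENNReal.ofReal (f x ξ) ∂φ = 1

/-- The site `x₀` `f`-desires the center `ξ₀`. -/
def SiteDesires (ψ : Measure (Space d)) (f : Space d → Space d → ℝ) (x₀ ξ₀ : Space d) : Prop :=
  f x₀ ξ₀ < 1 ∧ (¬ Exhausted ψ f x₀ ∨ ∃ ξ₁, dist x₀ ξ₀ < dist x₀ ξ₁ ∧ 0 < f x₀ ξ₁)

/-- The center `ξ₀` `f`-desires the site `x₀`. -/
def CenterDesires (φ : Measure (Space d)) (f : Space d → Space d → ℝ) (x₀ ξ₀ : Space d) : Prop :=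
  f x₀ ξ₀ < 1 ∧ (¬ Sated φ f ξ₀ ∨ ∃ x₁, dist x₀ ξ₀ < dist x₁ ξ₀ ∧ 0 < f x₁ ξ₀)

/-- `f` is a stable constrained density for `(φ, ψ)`: no two points `x₀`, `ξ₀` of `ℝ^d` desire
each other. -/
structure IsStableConstrainedDensity (φ ψ : Measure (Space d)) (f : Space d → Space d → ℝ) :
    Prop where
  constrained : IsConstrainedDensity φ ψ f
  stable : ∀ x₀ ξ₀, ¬ (SiteDesires ψ f x₀ ξ₀ ∧ CenterDesires φ f x₀ ξ₀)

/-- The territory of the site `x`. -/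
def siteTerritory (f : Space d → Space d → ℝ) (x : Space d) : Set (Space d) :=
  {ξ | 0 < f x ξ}

/-- The territory of the center `ξ`. -/
def centerTerritory (f : Space d → Space d → ℝ) (ξ : Space d) : Set (Space d) :=
  {x | 0 < f x ξ}

end Deterministic

end StableDensity

/-!
Write `ρ(ξ)` for the reach of a center `ξ`, the supremum of its distances to the points of its
territory. If `|x - ξ| < ρ(ξ)` and `x` has a partner farther away than `ξ`, then stability forces
`f(x, ξ) = 1`, which for a fixed `x` can happen only for unit mass of centers `ξ`. So it suffices to
produce more than unit mass of centers with large reach closer to `x` than a given partner of `x`.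
This is achieved by Poincaré recurrence along the translations by multiples of `v`, for `v` in a
finite set of directions: every point `y` satisfies `‖y‖ ≤ ⟪y, v⟫` for one of these directions, and
if `y` is remote, then moving from the origin to `k v` brings one closer to `y` by about `k`.

If centers with unbounded territory exist, they have infinite mass, and recurrence puts more than
unit mass of them near infinitely many of the points `k v`, hence closer to a remote partner `x` of
`ξ` than `ξ` itself. If the balls `B(ξ, ρ(ξ))` of infinite mass meet a bounded set, then recurrence
shows that infinite mass of these balls cover it, which bounds the territories of its points.

The reach is an uncountable supremum, so it is measurable only in the universal sense provided by
the measurable projection theorem.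
-/

namespace StableDensity

/-! ### Measurable projections -/

section AnalyticSet

theorem exists_nat_lt_measure_image_inter_le {α X R : Type*} [MeasurableSpace X] [Semiring R]
    [PartialOrder R] [IsOrderedRing R] [Archimedean R] {μ : Measure X} (f : α → X) (g : α → R)
    {s : Set α} {c : ℝ≥0∞} (h : c < μ (f '' s)) :
    ∃ n : ℕ, c < μ (f '' (s ∩ {a | g a ≤ n})) := by
  have hmono : Monotone fun n : ℕ => f '' (s ∩ {a | g a ≤ n}) := fun m n hmn =>
    Set.image_mono fun a ha => ⟨ha.1, ha.2.trans (Nat.mono_cast hmn)⟩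
  have hUnion : ⋃ n : ℕ, s ∩ {a | g a ≤ n} = s := by
    rw [← Set.inter_iUnion, Set.inter_eq_left]
    exact fun a _ => Set.mem_iUnion.2 (exists_nat_ge (g a))
  rwa [← hUnion, Set.image_iUnion, hmono.measure_iUnion, lt_iSup_iff] at h

/-- The closed subset of Baire space on which the first `k` coordinates are bounded by those of
`b`. These sets decrease to the compact set `Set.Iic b` as `k` grows. -/
def boundedPrefix (b : ℕ → ℕ) (k : ℕ) : Set (ℕ → ℕ) :=
  {α | ∀ i < k, α i ≤ b i}

theorem boundedPrefix_succ (b : ℕ → ℕ) (k : ℕ) :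
    boundedPrefix b (k + 1) = boundedPrefix b k ∩ {α | α k ≤ b k} := by
  ext α
  exact Nat.forall_lt_succ_right

theorem exists_forall_lt_measure_image_boundedPrefix {X : Type*} [MeasurableSpace X]
    {μ : Measure X} {f : (ℕ → ℕ) → X} {c : ℝ≥0∞} (hc : c < μ (Set.range f)) :
    ∃ b, ∀ k, c < μ (f '' boundedPrefix b k) := by
  have hbound (S : Set (ℕ → ℕ)) (k : ℕ) :
      ∃ n, c < μ (f '' S) → c < μ (f '' (S ∩ {α | α k ≤ n})) := by
    by_cases hS : c < μ (f '' S)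
    · obtain ⟨n, hn⟩ := exists_nat_lt_measure_image_inter_le f (fun α => α k) hS
      exact ⟨n, fun _ => hn⟩
    · exact ⟨0, fun h => absurd h hS⟩
  choose N hN using hbound
  let S : ℕ → Set (ℕ → ℕ) := Nat.rec Set.univ fun k S => S ∩ {α | α k ≤ N S k}
  have hS (k : ℕ) : c < μ (f '' S k) := by
    induction k with
    | zero => rwa [← Set.image_univ] at hc
    | succ k ih => exact hN _ _ ih
  refine ⟨fun k => N (S k) k, fun k => ?_⟩
  suffices boundedPrefix (fun k => N (S k) k) k = S k from this ▸ hS k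
  induction k with
  | zero => simp [boundedPrefix, S]
  | succ k ih => rw [boundedPrefix_succ, ih]

theorem exists_boundedPrefix_subset {b : ℕ → ℕ} {U : Set (ℕ → ℕ)} (hU : IsOpen U)
    (hb : Set.Iic b ⊆ U) : ∃ k, boundedPrefix b k ⊆ U := by
  let := PiNat.metricSpaceNatNat
  have hcompact : IsCompact (Set.Iic b) := Set.Icc_bot (a := b) ▸ isCompact_Icc
  obtain ⟨δ, hδ, hthick⟩ := hcompact.exists_thickening_subset_open hU hb
  obtain ⟨k, hk⟩ := exists_pow_lt_of_lt_one hδ (one_half_lt_one (α := ℝ))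
  refine ⟨k, fun α hα => hthick (Metric.mem_thickening_iff.2 ⟨α ⊓ b, ?_, ?_⟩)⟩
  · exact Set.mem_Iic.2 inf_le_right
  refine (PiNat.mem_cylinder_iff_dist_le.1 fun i hi => ?_).trans_lt hk
  exact (inf_eq_left.2 (hα i hi)).symm

variable {X : Type*} [TopologicalSpace X] [MeasurableSpace X] {s : Set X}

theorem exists_isCompact_subset_le_measure (hs : AnalyticSet s) (μ : Measure X) [μ.OuterRegular]
    {c : ℝ≥0∞} (hc : c < μ s) : ∃ K ⊆ s, IsCompact K ∧ c ≤ μ K := by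
  rw [AnalyticSet] at hs
  obtain rfl | ⟨f, hf, rfl⟩ := hs
  · simp at hc
  obtain ⟨b, hb⟩ := exists_forall_lt_measure_image_boundedPrefix hc
  have hcompact : IsCompact (Set.Iic b) := Set.Icc_bot (a := b) ▸ isCompact_Icc
  refine ⟨f '' Set.Iic b, Set.image_subset_range _ _, hcompact.image hf, ?_⟩
  rw [Set.measure_eq_iInf_isOpen]
  refine le_iInf₂ fun V hV => le_iInf fun hVo => ?_
  obtain ⟨k, hk⟩ := exists_boundedPrefix_subset (hVo.preimage hf) (Set.image_subset_iff.1 hV)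
  exact (hb k).le.trans (measure_mono (Set.image_subset_iff.2 hk))

theorem nullMeasurableSet_of_analyticSet [T2Space X] [OpensMeasurableSpace X]
    (hs : AnalyticSet s) (μ : Measure X) [IsFiniteMeasure μ] [μ.OuterRegular] :
    NullMeasurableSet s μ := by
  obtain ⟨t, hts, ht, hst⟩ : ∃ t ⊆ s, MeasurableSet t ∧ μ s ≤ μ t := by
    rcases eq_or_ne (μ s) 0 with h0 | h0
    · exact ⟨∅, s.empty_subset, .empty, by simp [h0]⟩
    obtain ⟨u, -, hu, hlim⟩ := exists_seq_strictMono_tendsto' (pos_iff_ne_zero.2 h0)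
    choose K hKs hK hKu using fun n => exists_isCompact_subset_le_measure hs μ (hu n).2
    refine ⟨⋃ n, K n, Set.iUnion_subset hKs, .iUnion fun n => (hK n).measurableSet, ?_⟩
    exact le_of_tendsto' hlim fun n => (hKu n).trans (measure_mono (Set.subset_iUnion K n))
  have hhull : t =ᵐ[μ] toMeasurable μ s :=
    ae_eq_of_subset_of_measure_ge (hts.trans (subset_toMeasurable μ s))
      (by rwa [measure_toMeasurable]) ht.nullMeasurableSet (measure_ne_top _ _)
  exact ht.nullMeasurableSet.congr <| hts.eventuallyLE.antisymm <|
    (subset_toMeasurable μ s).eventuallyLE.trans hhull.symm.le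

end AnalyticSet

section Projection

variable {Ω X : Type*} [MeasurableSpace Ω] [MeasurableSpace X]

/-- A measurable subset of a product involves only countably many measurable subsets of the first
factor; their indicators are the coordinates of `g`. -/
theorem exists_measurable_prodMap_preimage_eq {S : Set (Ω × X)} (hS : MeasurableSet S) :
    ∃ g : Ω → ℕ → Bool, Measurable g ∧
      ∃ A : Set ((ℕ → Bool) × X), MeasurableSet A ∧ Prod.map g id ⁻¹' A = S := by
  classical
  induction S, hS using MeasurableSpace.induction_on_inter generateFrom_prod.symm
      isPiSystem_prod with
  | empty => exact ⟨fun _ _ => false, measurable_const, ∅, .empty, rfl⟩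
  | basic S hS =>
    obtain ⟨u, hu, v, hv, rfl⟩ := hS
    refine ⟨fun ω _ => decide (ω ∈ u), measurable_pi_lambda _ fun _ => measurable_to_bool ?_,
      {b | b 0 = true} ×ˢ v, ?_, ?_⟩
    · simpa [Set.preimage] using hu
    · exact (measurableSet_eq_fun (measurable_pi_apply 0) measurable_const).prod hv
    · ext; simp
  | compl S _ ih =>
    obtain ⟨g, hg, A, hA, rfl⟩ := ih
    exact ⟨g, hg, Aᶜ, hA.compl, rfl⟩
  | iUnion S _ _ ih =>
    choose g hg A hA hgA using ih
    let row (n : ℕ) (b : ℕ → Bool) : ℕ → Bool := fun k => b (Nat.pair n k)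
    have hrow (n : ℕ) : Measurable (row n) :=
      measurable_pi_lambda _ fun k => measurable_pi_apply _
    refine ⟨fun ω m => g m.unpair.1 ω m.unpair.2, measurable_pi_lambda _ fun m =>
        (measurable_pi_apply _).comp (hg _), ⋃ n, Prod.map (row n) id ⁻¹' A n,
      .iUnion fun n => ((hrow n).prodMap measurable_id) (hA n), ?_⟩
    ext ⟨ω, x⟩
    simp [← hgA, row]

theorem nullMeasurableSet_image_fst [StandardBorelSpace X] {S : Set (Ω × X)}
    (hS : MeasurableSet S) (μ : Measure Ω) [SFinite μ] : NullMeasurableSet (Prod.fst '' S) μ := by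
  suffices NullMeasurableSet (Prod.fst '' S) μ.toFinite from
    this.mono_ac (absolutelyContinuous_toFinite μ)
  obtain ⟨g, hg, A, hA, rfl⟩ := exists_measurable_prodMap_preimage_eq hS
  have hanalytic : AnalyticSet (Prod.fst '' A) := hA.analyticSet_image measurable_fst
  convert! (nullMeasurableSet_of_analyticSet hanalytic (μ.toFinite.map g)).preimage
    (hg.quasiMeasurePreserving μ.toFinite) using 1
  ext
  simp

theorem aemeasurable_iSup_of_standardBorel [StandardBorelSpace X] {g : Ω → X → ℝ≥0∞}
    (hg : Measurable (Function.uncurry g)) (μ : Measure Ω) [SFinite μ] :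
    AEMeasurable (fun ω => ⨆ x, g ω x) μ := by
  suffices NullMeasurable (fun ω => ⨆ x, g ω x) μ from this.aemeasurable
  refine @measurable_of_Ioi _ (NullMeasurableSpace Ω μ) _ _ _ _ _ _ _ _ fun a => ?_
  have hpre : (fun ω => ⨆ x, g ω x) ⁻¹' Set.Ioi a =
      Prod.fst '' (Function.uncurry g ⁻¹' Set.Ioi a) := by
    ext ω
    simp [lt_iSup_iff]
  exact hpre ▸ nullMeasurableSet_image_fst (hg measurableSet_Ioi) μ

end Projection

/-! ### Kernels -/

section Kernel

open ProbabilityTheory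

variable {α β : Type*} [MeasurableSpace α] [MeasurableSpace β]

theorem isSFiniteKernel_of_forall_isFiniteMeasure (κ : Kernel α β)
    (hκ : ∀ a, IsFiniteMeasure (κ a)) : IsSFiniteKernel κ := by
  classical
  let N (a : α) : ℕ := ⌊(κ a Set.univ).toNNReal⌋₊
  have hN : Measurable N :=
    Nat.measurable_floor.comp (κ.measurable_coe MeasurableSet.univ).ennreal_toNNReal
  have hA (n : ℕ) : MeasurableSet (N ⁻¹' {n}) := hN (measurableSet_singleton n)
  have hsum : κ = Kernel.sum fun n => Kernel.piecewise (hA n) κ 0 := by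
    ext a s hs
    rw [Kernel.sum_apply' _ _ hs, tsum_eq_single (N a)]
    · simp [Kernel.piecewise_apply]
    · intro n hn
      simp [Kernel.piecewise_apply, hn.symm]
  have hfin (n : ℕ) : IsFiniteKernel (Kernel.piecewise (hA n) κ 0) := by
    refine ⟨(n + 1 : ℝ≥0), ENNReal.coe_lt_top, fun a => ?_⟩
    by_cases ha : N a = n
    · have hmass : κ a Set.univ < (n + 1 : ℝ≥0) := by
        rw [← ENNReal.coe_toNNReal (measure_ne_top (κ a) Set.univ), ENNReal.coe_lt_coe, ← ha]
        exact Nat.lt_floor_add_one _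
      simpa [Kernel.piecewise_apply, ha] using hmass.le
    · simp [Kernel.piecewise_apply, ha]
  rw [hsum]
  infer_instance

theorem isSFiniteKernel_of_forall_fiber_lt_top (κ : Kernel α β) {c : β → ℕ} (hc : Measurable c)
    (hκ : ∀ a n, κ a (c ⁻¹' {n}) < ∞) : IsSFiniteKernel κ := by
  have hA (n : ℕ) : MeasurableSet (c ⁻¹' {n}) := hc (measurableSet_singleton n)
  have hsum : κ = Kernel.sum fun n => κ.restrict (hA n) := by
    have hUnion : ⋃ n, c ⁻¹' {n} = Set.univ := by
      ext
      simp
    ext a : 1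
    rw [Kernel.sum_apply, ← Measure.restrict_univ (μ := κ a), ← hUnion,
      Measure.restrict_iUnion (fun i j hij => Disjoint.preimage c (by simpa using hij)) hA]
    simp_rw [Kernel.restrict_apply]
  have hfin (n : ℕ) : IsSFiniteKernel (κ.restrict (hA n)) := by
    refine isSFiniteKernel_of_forall_isFiniteMeasure _ fun a => ⟨?_⟩
    rw [Kernel.restrict_apply, Measure.restrict_apply_univ]
    exact hκ a n
  rw [hsum]
  infer_instance

theorem aemeasurable_kernel_prodMk_preimage (μ : Measure α) [SFinite μ] (κ : Kernel α β)
    [IsSFiniteKernel κ] {S : Set (α × β)} (hS : NullMeasurableSet S (μ ⊗ₘ κ)) :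
    AEMeasurable (fun a => κ a (Prod.mk a ⁻¹' S)) μ := by
  obtain ⟨t, ht, hSt⟩ := hS
  refine ⟨fun a => κ a (Prod.mk a ⁻¹' t), Kernel.measurable_kernel_prodMk_left ht, ?_⟩
  filter_upwards [Measure.ae_ae_of_ae_compProd hSt] with a ha
  exact measure_congr ha

end Kernel

/-! ### Translations along finitely many directions -/

section Direction

open Filter

variable {E : Type*} [NormedAddCommGroup E] [InnerProductSpace ℝ E]

variable (E) in
theorem exists_finite_forall_norm_le_inner [ProperSpace E] :
    ∃ V : Set E, V.Finite ∧ ∀ y : E, ∃ v ∈ V, ‖y‖ ≤ inner ℝ y v := by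
  obtain ⟨C, hCs, hC, hcover⟩ :=
    (isCompact_sphere (0 : E) 1).finite_cover_balls (e := 1) one_pos
  refine ⟨insert 0 ((fun c => (2 : ℝ) • c) '' C), (hC.image _).insert 0, fun y => ?_⟩
  rcases eq_or_ne y 0 with rfl | hy
  · exact ⟨0, Set.mem_insert _ _, by simp⟩
  have hy' : 0 < ‖y‖ := norm_pos_iff.2 hy
  have hy1 : ‖y‖⁻¹ • y ∈ Metric.sphere (0 : E) 1 := by simp [norm_smul, hy]
  obtain ⟨c, hc, hyc⟩ := Set.mem_iUnion₂.1 (hcover hy1)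
  refine ⟨(2 : ℝ) • c, Set.mem_insert_of_mem _ (Set.mem_image_of_mem _ hc), ?_⟩
  have hdist : ‖‖y‖⁻¹ • y - c‖ ^ 2 < 1 := by
    rw [← dist_eq_norm]
    exact pow_lt_one₀ dist_nonneg hyc two_ne_zero
  have hc1 : ‖c‖ = 1 := by simpa using hCs hc
  rw [norm_sub_sq_real, norm_smul, norm_inv, norm_norm, inv_mul_cancel₀ hy'.ne', hc1,
    real_inner_smul_left] at hdist
  have hinner : 1 < ‖y‖⁻¹ * (2 * inner ℝ y c) := by linarith
  rw [lt_inv_mul_iff₀ hy', mul_one] at hinner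
  exact hinner.le.trans_eq (real_inner_smul_right _ _ _).symm

theorem norm_sub_smul_add_lt {y v : E} (hyv : ‖y‖ ≤ inner ℝ y v) {s t : ℝ} (hs : 0 ≤ s)
    (hst : s + 1 ≤ t) (hy : (t * ‖v‖) ^ 2 + s < ‖y‖) : ‖y - t • v‖ + s < ‖y‖ := by
  have hinner : (s + 1) * ‖y‖ ≤ t * inner ℝ y v :=
    mul_le_mul hst hyv (norm_nonneg _) (by linarith)
  have hsq : ‖y - t • v‖ ^ 2 < (‖y‖ - s) ^ 2 := by
    rw [norm_sub_sq_real, inner_smul_right, norm_smul, Real.norm_eq_abs, mul_pow, sq_abs,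
      ← mul_pow]
    nlinarith
  have hs_le : 0 ≤ ‖y‖ - s := by linarith [sq_nonneg (t * ‖v‖)]
  linarith [lt_of_pow_lt_pow_left₀ 2 hs_le hsq]

variable [MeasurableSpace E]

theorem measure_norm_sub_smul_add_lt_eq_top [ProperSpace E] [OpensMeasurableSpace E]
    {μ : Measure E} [IsLocallyFiniteMeasure μ] {ρ : E → ℝ≥0∞} {v : E} {r r' k : ℕ}
    (hk : r + r' + 1 ≤ k) (h : μ {ξ | ‖ξ‖ₑ ≤ ρ ξ + r ∧ ‖ξ‖ ≤ inner ℝ ξ v} = ∞) :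
    μ {ξ | ‖ξ - (k : ℝ) • v‖ₑ + r' < ρ ξ} = ∞ := by
  let R : ℝ := (k * ‖v‖) ^ 2 + (r + r')
  refine measure_mono_top ?_ (measure_sdiff_eq_top h
    (measure_closedBall_lt_top (x := (0 : E)) (r := R)).ne)
  rintro ξ ⟨⟨hξρ, hξv⟩, hξR⟩
  rw [mem_closedBall_zero_iff, not_le] at hξR
  have hlt : ‖ξ - (k : ℝ) • v‖ + (r + r') < ‖ξ‖ :=
    norm_sub_smul_add_lt hξv (by positivity) (by exact_mod_cast hk) hξR
  have helt : ‖ξ - (k : ℝ) • v‖ₑ + r' + r < ‖ξ‖ₑ := by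
    simp only [← ofReal_norm, ← ENNReal.ofReal_natCast]
    rw [← ENNReal.ofReal_add (by positivity) (by positivity),
      ← ENNReal.ofReal_add (by positivity) (by positivity),
      ENNReal.ofReal_lt_ofReal_iff_of_nonneg (by positivity)]
    linarith
  exact lt_of_add_lt_add_right (helt.trans_le hξρ)

theorem measure_eq_top_of_frequently_lt_measure_inter_closedBall [OpensMeasurableSpace E]
    {μ : Measure E} {s : Set E} {v : E} (hv : v ≠ 0) {c : ℝ≥0∞} (hc : c ≠ 0) {n : ℕ}
    (h : ∃ᶠ k : ℕ in atTop, c < μ (s ∩ Metric.closedBall ((k : ℝ) • v) n)) : μ s = ∞ := by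
  by_contra hs
  have : IsFiniteMeasure (μ.restrict s) := isFiniteMeasure_restrict.2 hs
  have hanti : Antitone fun m : ℕ => (Metric.closedBall (0 : E) m)ᶜ := fun m m' hm =>
    Set.compl_subset_compl.2 (Metric.closedBall_subset_closedBall (Nat.cast_le.2 hm))
  have hlim := tendsto_measure_iInter_atTop (μ := μ.restrict s)
    (fun m => Metric.isClosed_closedBall.measurableSet.compl.nullMeasurableSet) hanti
    ⟨0, measure_ne_top _ _⟩
  rw [← Set.compl_iUnion, Metric.iUnion_closedBall_nat, Set.compl_univ, measure_empty] at hlim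
  obtain ⟨m, hm⟩ := (hlim.eventually_lt_const (pos_iff_ne_zero.2 hc)).exists
  have hfar : Tendsto (fun k : ℕ => (k : ℝ) * ‖v‖) atTop atTop :=
    tendsto_natCast_atTop_atTop.atTop_mul_const (norm_pos_iff.2 hv)
  obtain ⟨k, hk, hkm⟩ := (h.and_eventually (hfar.eventually_gt_atTop (m + n : ℝ))).exists
  refine (hk.trans_le ?_).not_ge hm.le
  rw [Set.inter_comm, ← Measure.restrict_apply Metric.isClosed_closedBall.measurableSet]
  refine measure_mono fun ξ hξ hξm => hkm.not_ge ?_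
  rw [mem_closedBall_zero_iff] at hξm
  rw [mem_closedBall_iff_norm'] at hξ
  calc k * ‖v‖ = ‖(k : ℝ) • v‖ := by simp [norm_smul]
    _ ≤ ‖ξ‖ + ‖(k : ℝ) • v - ξ‖ := norm_le_norm_add_norm_sub' _ _
    _ ≤ m + n := add_le_add hξm hξ

end Direction

/-! ### Flow-adapted marks -/

section Mark

open Filter ProbabilityTheory

variable {d : ℕ} {Ω β : Type*} [MeasurableSpace Ω] [MeasurableSpace β]
  {θ : Space d → Ω → Ω} {P : Measure Ω} {Ψ : Ω → Measure (Space d)} {ρ : Ω → Space d → β}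

/-- A random field of marks `ρ_ω(ξ)` on `ℝ^d` that moves along with the flow `θ`. Its joint
measurability is only required up to null sets of every s-finite measure, so as to allow for
uncountable suprema of measurable fields. -/
structure IsFlowAdaptedMark (θ : Space d → Ω → Ω) (ρ : Ω → Space d → β) : Prop where
  aemeasurable : ∀ (ν : Measure (Ω × Space d)) [SFinite ν], AEMeasurable (Function.uncurry ρ) ν
  flowAdapted : ∀ s ω ξ, ρ (θ s ω) ξ = ρ ω (ξ + s)

theorem IsMeasurableFlow.iterate_eq (hθ : IsMeasurableFlow θ) (v : Space d) (k : ℕ) :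
    (θ v)^[k] = θ ((k : ℝ) • v) := by
  induction k with
  | zero =>
    ext ω
    simp [hθ.zero]
  | succ k ih =>
    ext ω
    rw [Function.iterate_succ_apply', ih, hθ.comp, Nat.cast_succ, add_smul, one_smul, add_comm]

namespace IsStationaryRandomMeasure

/-- A stationary random measure as a kernel from `Ω` to `ℝ^d`. -/
def kernel (hΨ : IsStationaryRandomMeasure θ P Ψ) : Kernel Ω (Space d) :=
  ⟨Ψ, hΨ.measurable⟩

theorem isSFiniteKernel (hΨ : IsStationaryRandomMeasure θ P Ψ) : IsSFiniteKernel hΨ.kernel := by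
  refine isSFiniteKernel_of_forall_fiber_lt_top _ (c := fun ξ => ⌊‖ξ‖⌋₊)
    (Nat.measurable_floor.comp measurable_norm) fun ω n => ?_
  have := hΨ.locallyFinite ω
  refine (measure_mono fun ξ hξ => ?_).trans_lt
    (measure_closedBall_lt_top (μ := Ψ ω) (x := 0) (r := n + 1))
  rw [mem_closedBall_zero_iff, ← Set.mem_singleton_iff.1 hξ]
  exact (Nat.lt_floor_add_one _).le

theorem measure_mark_shift (hΨ : IsStationaryRandomMeasure θ P Ψ) (hρ : IsFlowAdaptedMark θ ρ)
    (A : Set (β × Space d)) (s : Space d) (ω : Ω) :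
    Ψ (θ s ω) {ξ | (ρ (θ s ω) ξ, ξ) ∈ A} = Ψ ω {ξ | (ρ ω ξ, ξ - s) ∈ A} := by
  rw [hΨ.flowAdapted, shiftMeasure]
  refine ((MeasurableEquiv.subRight s).map_apply _).trans ?_
  change Ψ ω {ξ | (ρ (θ s ω) (ξ - s), ξ - s) ∈ A} = _
  simp only [hρ.flowAdapted, sub_add_cancel]

theorem aemeasurable_measure_mark [SFinite P] (hΨ : IsStationaryRandomMeasure θ P Ψ)
    (hρ : IsFlowAdaptedMark θ ρ) {A : Set (β × Space d)} (hA : MeasurableSet A) :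
    AEMeasurable (fun ω => Ψ ω {ξ | (ρ ω ξ, ξ) ∈ A}) P := by
  have := hΨ.isSFiniteKernel
  have hmark := (hρ.aemeasurable (P ⊗ₘ hΨ.kernel)).prodMk measurable_snd.aemeasurable
  exact aemeasurable_kernel_prodMk_preimage P hΨ.kernel (hmark.nullMeasurableSet_preimage hA)

variable [IsFiniteMeasure P]

theorem ae_frequently_measure_mark_mem (hΨ : IsStationaryRandomMeasure θ P Ψ)
    (hθ : IsMeasurableFlow θ) (hρ : IsFlowAdaptedMark θ ρ) {A : Set (β × Space d)}
    (hA : MeasurableSet A) {T : Set ℝ≥0∞} (hT : MeasurableSet T) (v : Space d) :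
    ∀ᵐ ω ∂P, Ψ ω {ξ | (ρ ω ξ, ξ) ∈ A} ∈ T →
      ∃ᶠ k : ℕ in atTop, Ψ ω {ξ | (ρ ω ξ, ξ - (k : ℝ) • v) ∈ A} ∈ T := by
  have hnull := (hΨ.aemeasurable_measure_mark hρ hA).nullMeasurableSet_preimage hT
  filter_upwards [(hΨ.stationary v).conservative.ae_mem_imp_frequently_image_mem hnull]
    with ω hω hωT
  refine (hω hωT).mono fun k hk => ?_
  rwa [hθ.iterate_eq, Set.mem_preimage, hΨ.measure_mark_shift hρ] at hk

theorem ae_exists_frequently_lt_measure_inter_closedBall (hΨ : IsStationaryRandomMeasure θ P Ψ)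
    (hθ : IsMeasurableFlow θ) (hρ : IsFlowAdaptedMark θ ρ) {S : Set β} (hS : MeasurableSet S)
    (c : ℝ≥0∞) (v : Space d) :
    ∀ᵐ ω ∂P, c < Ψ ω (ρ ω ⁻¹' S) →
      ∃ n : ℕ, ∃ᶠ k : ℕ in atTop,
        c < Ψ ω (ρ ω ⁻¹' S ∩ Metric.closedBall ((k : ℝ) • v) n) := by
  have hrec (n : ℕ) := hΨ.ae_frequently_measure_mark_mem hθ hρ
    (hS.prod (Metric.isClosed_closedBall (x := (0 : Space d)) (ε := n)).measurableSet)
    (measurableSet_Ioi (a := c)) v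
  filter_upwards [ae_all_iff.2 hrec] with ω hω hc
  rw [← Set.image_id (ρ ω ⁻¹' S)] at hc
  obtain ⟨n, hn⟩ := exists_nat_lt_measure_image_inter_le id norm hc
  refine ⟨n, (hω n ?_).mono fun k hk => ?_⟩
  · simpa [Set.preimage, Set.ofPred_and] using hn
  · simpa [Set.preimage, Set.ofPred_and, Metric.closedBall, dist_eq_norm] using hk

theorem ae_measure_mark_eq_zero_or_top [Nontrivial (Space d)]
    (hΨ : IsStationaryRandomMeasure θ P Ψ) (hθ : IsMeasurableFlow θ) (hρ : IsFlowAdaptedMark θ ρ)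
    {S : Set β} (hS : MeasurableSet S) :
    ∀ᵐ ω ∂P, Ψ ω (ρ ω ⁻¹' S) = 0 ∨ Ψ ω (ρ ω ⁻¹' S) = ∞ := by
  obtain ⟨v, hv⟩ := exists_ne (0 : Space d)
  filter_upwards [ae_all_iff.2 fun j : ℕ =>
    hΨ.ae_exists_frequently_lt_measure_inter_closedBall hθ hρ hS (j : ℝ≥0∞)⁻¹ v] with ω hω
  refine or_iff_not_imp_left.2 fun h0 => ?_
  obtain ⟨j, hj⟩ := ENNReal.exists_inv_nat_lt h0
  obtain ⟨n, hn⟩ := hω j hj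
  exact measure_eq_top_of_frequently_lt_measure_inter_closedBall hv
    (ENNReal.inv_ne_zero.2 (ENNReal.natCast_ne_top j)) hn

/-- In terms of the balls `B(ξ, ρ(ξ))`: if infinite mass of them meets a ball around the origin,
then infinite mass of them covers any given ball around the origin. -/
theorem ae_measure_covering_eq_top {ρ : Ω → Space d → ℝ≥0∞}
    (hΨ : IsStationaryRandomMeasure θ P Ψ) (hθ : IsMeasurableFlow θ)
    (hρ : IsFlowAdaptedMark θ ρ) :
    ∀ᵐ ω ∂P, ∀ r : ℕ, Ψ ω {ξ | ‖ξ‖ₑ ≤ ρ ω ξ + r} = ∞ →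
      ∀ r' : ℕ, Ψ ω {ξ | ‖ξ‖ₑ + r' < ρ ω ξ} = ∞ := by
  obtain ⟨V, hV, hVinner⟩ := exists_finite_forall_norm_le_inner (Space d)
  have hrec (v : Space d) (r' : ℕ) := hΨ.ae_frequently_measure_mark_mem hθ hρ
    (A := {p | ‖p.2‖ₑ + r' < p.1}) (measurableSet_lt (by fun_prop) (by fun_prop))
    (measurableSet_singleton ∞).compl v
  filter_upwards [(ae_ball_iff hV.countable).2 fun v _ => ae_all_iff.2 (hrec v)]
    with ω hω r hr r'
  have := hΨ.locallyFinite ω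
  obtain ⟨v, hv, hvr⟩ : ∃ v ∈ V, Ψ ω {ξ | ‖ξ‖ₑ ≤ ρ ω ξ + r ∧ ‖ξ‖ ≤ inner ℝ ξ v} = ∞ := by
    by_contra! hfin
    refine (measure_biUnion_lt_top hV fun v hv => (hfin v hv).lt_top).ne
      (measure_mono_top (fun ξ hξ => ?_) hr)
    obtain ⟨v, hv, hξv⟩ := hVinner ξ
    exact Set.mem_biUnion hv ⟨hξ, hξv⟩
  by_contra hfin
  obtain ⟨k, hk, hkr⟩ := ((hω v hv r' hfin).and_eventually
    (eventually_ge_atTop (r + r' + 1))).exists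
  exact hk (measure_norm_sub_smul_add_lt_eq_top hkr hvr)

end IsStationaryRandomMeasure

end Mark

/-! ### The reach of a center -/

section Reach

open Filter Bornology

variable {d : ℕ} {φ ψ : Measure (Space d)} {f : Space d → Space d → ℝ}

/-- The reach of the center `ξ`: the supremum of its distances to the points of its territory, which
is `0` if the territory is empty. -/
noncomputable def reach (f : Space d → Space d → ℝ) (ξ : Space d) : ℝ≥0∞ :=
  ⨆ x ∈ centerTerritory f ξ, edist x ξ

theorem edist_le_reach {x ξ : Space d} (h : 0 < f x ξ) : edist x ξ ≤ reach f ξ :=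
  le_iSup₂ (f := fun x (_ : x ∈ centerTerritory f ξ) => edist x ξ) x h

theorem lt_reach_iff {a : ℝ≥0∞} {ξ : Space d} :
    a < reach f ξ ↔ ∃ x, 0 < f x ξ ∧ a < edist x ξ := by
  simp only [reach, lt_iSup_iff, exists_prop]
  rfl

theorem reach_ne_top_iff {ξ : Space d} : reach f ξ ≠ ∞ ↔ IsBounded (centerTerritory f ξ) := by
  refine ⟨fun h => Metric.isBounded_closedBall (x := ξ) (r := (reach f ξ).toReal) |>.subset
    fun x hx => ?_, fun h => ?_⟩
  · rw [Metric.mem_closedBall, dist_edist]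
    exact ENNReal.toReal_mono h (edist_le_reach hx)
  · exact ne_top_of_le_ne_top (h.insert ξ).ediam_ne_top <| iSup₂_le fun x hx =>
      Metric.edist_le_ediam_of_mem (Set.mem_insert_of_mem _ hx) (Set.mem_insert _ _)

theorem iUnion_siteTerritory_subset {r : ℕ} {B : Set (Space d)} (hB : B ⊆ Metric.closedBall 0 r) :
    ⋃ x ∈ B, siteTerritory f x ⊆ {ξ | ‖ξ‖ₑ ≤ reach f ξ + r} := by
  refine Set.iUnion₂_subset fun x hx ξ hξ => ?_
  have hxr : ‖x‖ₑ ≤ r := by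
    rw [← ofReal_norm, ← ENNReal.ofReal_natCast]
    exact ENNReal.ofReal_le_ofReal (mem_closedBall_zero_iff.1 (hB hx))
  calc ‖ξ‖ₑ ≤ edist x ξ + ‖x‖ₑ := by
        rw [← edist_zero_right, ← edist_zero_right, edist_comm x ξ]
        exact edist_triangle _ _ _
    _ ≤ reach f ξ + r := add_le_add (edist_le_reach hξ) hxr

theorem IsConstrainedDensity.measure_eq_one_le (hf : IsConstrainedDensity φ ψ f) (x : Space d) :
    ψ {ξ | f x ξ = 1} ≤ 1 := by
  have hfx : Measurable fun ξ => ENNReal.ofReal (f x ξ) :=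
    (hf.measurable.comp measurable_prodMk_left).ennreal_ofReal
  calc ψ {ξ | f x ξ = 1} ≤ ψ {ξ | 1 ≤ ENNReal.ofReal (f x ξ)} :=
        measure_mono fun ξ (hξ : f x ξ = 1) => by simp [hξ]
    _ = 1 * ψ {ξ | 1 ≤ ENNReal.ofReal (f x ξ)} := (one_mul _).symm
    _ ≤ ∫⁻ ξ, ENNReal.ofReal (f x ξ) ∂ψ := mul_meas_ge_le_lintegral hfx 1
    _ ≤ 1 := hf.site_le x

namespace IsStableConstrainedDensity

theorem eq_one (hf : IsStableConstrainedDensity φ ψ f) {x ξ ξ' : Space d} (hξ : 0 < f x ξ)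
    (hd : dist x ξ' < dist x ξ) (hreach : edist x ξ' < reach f ξ') : f x ξ' = 1 := by
  obtain ⟨x', hx', hd'⟩ := lt_reach_iff.1 hreach
  rw [edist_dist x', edist_lt_ofReal] at hd'
  by_contra hne
  have hlt := (hf.constrained.le_one x ξ').lt_of_ne hne
  exact hf.stable x ξ' ⟨⟨hlt, .inr ⟨ξ, hd, hξ⟩⟩, ⟨hlt, .inr ⟨x', hd', hx'⟩⟩⟩

theorem measure_reach_eq_top_inter_ball_le (hf : IsStableConstrainedDensity φ ψ f)
    {x ξ : Space d} (hx : 0 < f x ξ) :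
    ψ (reach f ⁻¹' {∞} ∩ Metric.ball x (dist x ξ)) ≤ 1 := by
  refine (measure_mono ?_).trans (hf.constrained.measure_eq_one_le x)
  rintro η ⟨hη, hηx⟩
  rw [Metric.mem_ball'] at hηx
  refine hf.eq_one hx hηx ?_
  rw [show reach f η = ∞ from hη]
  exact edist_lt_top _ _

theorem exists_forall_eventually_measure_le_one (hf : IsStableConstrainedDensity φ ψ f)
    {V : Set (Space d)} (hV : V.Finite) (hVinner : ∀ y : Space d, ∃ v ∈ V, ‖y‖ ≤ inner ℝ y v)
    {ξ : Space d} (hξ : reach f ξ = ∞) :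
    ∃ v ∈ V, ∀ n : ℕ, ∀ᶠ k : ℕ in atTop,
      ψ (reach f ⁻¹' {∞} ∩ Metric.closedBall ((k : ℝ) • v) n) ≤ 1 := by
  have hremote : ∃ᶠ x in cobounded (Space d), 0 < f x ξ := fun h =>
    reach_ne_top_iff.2 (isBounded_def.2 h) hξ
  obtain ⟨v, hv, hfreq⟩ : ∃ v ∈ V, ∃ᶠ x in cobounded (Space d),
      0 < f x ξ ∧ ‖x - ξ‖ ≤ inner ℝ (x - ξ) v := by
    by_contra! hcon
    refine hremote ?_
    filter_upwards [(eventually_all_finite hV).2 hcon] with x hx hxξ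
    obtain ⟨v, hv, hxv⟩ := hVinner (x - ξ)
    exact (hx v hv hxξ).not_ge hxv
  refine ⟨v, hv, fun n => ?_⟩
  filter_upwards [tendsto_natCast_atTop_atTop.eventually_ge_atTop (n + ‖ξ‖ + 1)] with k hk
  have hfar : ∀ᶠ x in cobounded (Space d), ((k : ℝ) * ‖v‖) ^ 2 + (n + ‖ξ‖) < ‖x - ξ‖ := by
    simpa only [dist_eq_norm] using
      (Metric.tendsto_dist_right_cobounded_atTop ξ).eventually_gt_atTop _
  obtain ⟨x, ⟨hx, hxv⟩, hxk⟩ := (hfreq.and_eventually hfar).exists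
  refine (measure_mono (Set.inter_subset_inter_right _ fun η hη => ?_)).trans
    (hf.measure_reach_eq_top_inter_ball_le hx)
  rw [mem_closedBall_iff_norm'] at hη
  rw [Metric.mem_ball', dist_eq_norm, dist_eq_norm]
  calc ‖x - η‖ = ‖(x - ξ - (k : ℝ) • v) + ξ + ((k : ℝ) • v - η)‖ := by congr 1; abel
    _ ≤ ‖x - ξ - (k : ℝ) • v‖ + ‖ξ‖ + n := (norm_add₃_le).trans (by gcongr)
    _ = ‖x - ξ - (k : ℝ) • v‖ + (n + ‖ξ‖) := by ring
    _ < ‖x - ξ‖ := norm_sub_smul_add_lt hxv (by positivity) hk hxk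

theorem isBounded_iUnion_siteTerritory (hf : IsStableConstrainedDensity φ ψ f) {r : ℕ}
    (h : 1 < ψ {ξ | ‖ξ‖ₑ + r < reach f ξ}) {B : Set (Space d)}
    (hB : B ⊆ Metric.closedBall 0 r) : IsBounded (⋃ x ∈ B, siteTerritory f x) := by
  rw [← Set.image_id {ξ | _ < _}] at h
  obtain ⟨n, hn⟩ := exists_nat_lt_measure_image_inter_le id norm h
  rw [Set.image_id] at hn
  refine (Metric.isBounded_closedBall (x := (0 : Space d)) (r := r + (r + n))).subset ?_
  refine Set.iUnion₂_subset fun x hx ξ hξ => ?_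
  have hxr : ‖x‖ ≤ r := mem_closedBall_zero_iff.1 (hB hx)
  obtain ⟨η, ⟨hη, hηn⟩, hη1⟩ : ∃ η ∈ {η | ‖η‖ₑ + r < reach f η} ∩ {η | ‖η‖ ≤ n}, f x η ≠ 1 := by
    by_contra! hcon
    exact hn.not_ge ((measure_mono hcon).trans (hf.constrained.measure_eq_one_le x))
  have hreach : edist x η < reach f η := by
    refine lt_of_le_of_lt ?_ hη
    rw [edist_dist, ← ofReal_norm, ← ENNReal.ofReal_natCast,
      ← ENNReal.ofReal_add (by positivity) (by positivity), dist_eq_norm']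
    exact ENNReal.ofReal_le_ofReal ((norm_sub_le _ _).trans (by gcongr))
  have hle : dist x ξ ≤ dist x η := not_lt.1 fun hlt => hη1 (hf.eq_one hξ hlt hreach)
  rw [mem_closedBall_zero_iff]
  calc ‖ξ‖ ≤ ‖x‖ + ‖x - ξ‖ := norm_le_norm_add_norm_sub _ _
    _ ≤ ‖x‖ + ‖x - η‖ := by simpa only [dist_eq_norm, add_le_add_iff_left] using hle
    _ ≤ r + (r + n) := add_le_add hxr ((norm_sub_le _ _).trans (add_le_add hxr hηn))

theorem swap (hf : IsStableConstrainedDensity φ ψ f) :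
    IsStableConstrainedDensity ψ φ fun x ξ => f ξ x where
  constrained :=
    { measurable := hf.constrained.measurable.comp measurable_swap
      nonneg := fun x ξ => hf.constrained.nonneg ξ x
      le_one := fun x ξ => hf.constrained.le_one ξ x
      site_le := hf.constrained.center_le
      center_le := hf.constrained.site_le }
  stable := by
    rintro x ξ ⟨⟨hlt, hsite⟩, -, hcenter⟩
    refine hf.stable ξ x ⟨⟨hlt, ?_⟩, hlt, ?_⟩
    · exact hcenter.imp_right <| by simp only [dist_comm, imp_self]
    · exact hsite.imp_right <| by simp only [dist_comm, imp_self]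

end IsStableConstrainedDensity

end Reach

section Random

open Bornology

variable {d : ℕ} {Ω : Type*} [MeasurableSpace Ω] {θ : Space d → Ω → Ω} {P : Measure Ω}
  {Φ Ψ : Ω → Measure (Space d)} {F : Ω → Space d → Space d → ℝ}

namespace IsFlowAdaptedFunction

theorem swap (hF : IsFlowAdaptedFunction θ F) : IsFlowAdaptedFunction θ fun ω x ξ => F ω ξ x where
  measurable := hF.measurable.comp (by fun_prop :
    Measurable fun p : Ω × Space d × Space d => (p.1, p.2.2, p.2.1))
  flowAdapted s ω x ξ := hF.flowAdapted s ω ξ x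

theorem isFlowAdaptedMark_reach (hF : IsFlowAdaptedFunction θ F) :
    IsFlowAdaptedMark θ fun ω => reach (F ω) where
  aemeasurable ν _ := by
    classical
    refine aemeasurable_iSup_of_standardBorel (Ω := Ω × Space d) (X := Space d) ?_ ν
    simp only [iSup_eq_if]
    have hpos : MeasurableSet {p : (Ω × Space d) × Space d | 0 < F p.1.1 p.2 p.1.2} :=
      measurableSet_lt measurable_const (hF.measurable.comp (by fun_prop :
        Measurable fun p : (Ω × Space d) × Space d => (p.1.1, p.2, p.1.2)))
    exact Measurable.ite hpos (by fun_prop) measurable_const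
  flowAdapted s ω ξ := by
    simp only [reach, centerTerritory, Set.mem_ofPred_eq, hF.flowAdapted]
    exact (iSup_congr fun x => by rw [Equiv.coe_addRight, edist_add_right]).trans <|
      (Equiv.addRight s).iSup_comp (g := fun x => ⨆ _ : 0 < F ω x (ξ + s), edist x (ξ + s))

end IsFlowAdaptedFunction

variable [IsFiniteMeasure P]

theorem ae_isBounded_centerTerritory (hθ : IsMeasurableFlow θ)
    (hΨ : IsStationaryRandomMeasure θ P Ψ) (hF : IsFlowAdaptedFunction θ F)
    (hFs : ∀ᵐ ω ∂P, IsStableConstrainedDensity (Φ ω) (Ψ ω) (F ω)) :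
    ∀ᵐ ω ∂P, ∀ᵐ ξ ∂(Ψ ω), IsBounded (centerTerritory (F ω) ξ) := by
  rcases subsingleton_or_nontrivial (Space d) with hd | hd
  · exact .of_forall fun ω => .of_forall fun ξ => .all _
  have hρ := hF.isFlowAdaptedMark_reach
  obtain ⟨V, hV, hVinner⟩ := exists_finite_forall_norm_le_inner (Space d)
  filter_upwards [hFs, hΨ.ae_measure_mark_eq_zero_or_top hθ hρ (measurableSet_singleton ∞),
    (ae_ball_iff hV.countable).2 fun v _ =>
      hΨ.ae_exists_frequently_lt_measure_inter_closedBall hθ hρ (measurableSet_singleton ∞) 1 v]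
    with ω hf hzero hfreq
  have hnull : Ψ ω (reach (F ω) ⁻¹' {∞}) = 0 := by
    refine hzero.resolve_right fun htop => ?_
    obtain ⟨ξ, hξ⟩ := nonempty_of_measure_ne_zero (htop ▸ ENNReal.top_ne_zero)
    obtain ⟨v, hv, hle⟩ := hf.exists_forall_eventually_measure_le_one hV hVinner hξ
    obtain ⟨n, hn⟩ := hfreq v hv (ENNReal.one_lt_top.trans_eq htop.symm)
    exact hn ((hle n).mono fun k => not_lt.2)
  filter_upwards [measure_eq_zero_iff_ae_notMem.1 hnull] with ξ hξ
  exact reach_ne_top_iff.1 hξ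

theorem ae_measure_iUnion_siteTerritory_lt_top (hθ : IsMeasurableFlow θ)
    (hΨ : IsStationaryRandomMeasure θ P Ψ) (hF : IsFlowAdaptedFunction θ F)
    (hFs : ∀ᵐ ω ∂P, IsStableConstrainedDensity (Φ ω) (Ψ ω) (F ω)) :
    ∀ᵐ ω ∂P, ∀ B : Set (Space d), IsBounded B → Ψ ω (⋃ x ∈ B, siteTerritory (F ω) x) < ∞ := by
  filter_upwards [hFs, hΨ.ae_measure_covering_eq_top hθ hF.isFlowAdaptedMark_reach]
    with ω hf hcover B hB
  have := hΨ.locallyFinite ω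
  obtain ⟨R, hR⟩ := hB.subset_closedBall 0
  obtain ⟨r, hr⟩ := exists_nat_ge R
  have hBr : B ⊆ Metric.closedBall 0 r := hR.trans (Metric.closedBall_subset_closedBall hr)
  by_cases htop : Ψ ω {ξ | ‖ξ‖ₑ ≤ reach (F ω) ξ + r} = ∞
  · have hmass : 1 < Ψ ω {ξ | ‖ξ‖ₑ + r < reach (F ω) ξ} := by
      rw [hcover r htop r]
      exact ENNReal.one_lt_top
    exact (hf.isBounded_iUnion_siteTerritory hmass hBr).measure_lt_top
  · exact (measure_mono (iUnion_siteTerritory_subset hBr)).trans_lt (lt_top_iff_ne_top.2 htop)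

end Random

end StableDensity

theorem theorem3p19_general {d : ℕ} {Ω : Type*} [MeasurableSpace Ω]
    {θ : StableDensity.Space d → Ω → Ω} (hθ : StableDensity.IsMeasurableFlow θ)
    {P : Measure Ω} [IsFiniteMeasure P] {Φ Ψ : Ω → Measure (StableDensity.Space d)}
    (hΦ : StableDensity.IsStationaryRandomMeasure θ P Φ)
    (hΨ : StableDensity.IsStationaryRandomMeasure θ P Ψ)
    {F : Ω → StableDensity.Space d → StableDensity.Space d → ℝ}
    (hF : StableDensity.IsFlowAdaptedFunction θ F)
    (hFs : ∀ᵐ ω ∂P, StableDensity.IsStableConstrainedDensity (Φ ω) (Ψ ω) (F ω)) :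
    ∀ᵐ ω ∂P,
      (∀ᵐ x ∂(Φ ω), Bornology.IsBounded (StableDensity.siteTerritory (F ω) x)) ∧
      (∀ᵐ ξ ∂(Ψ ω), Bornology.IsBounded (StableDensity.centerTerritory (F ω) ξ)) ∧
      (∀ B : Set (StableDensity.Space d), Bornology.IsBounded B →
        Ψ ω (⋃ x ∈ B, StableDensity.siteTerritory (F ω) x) < ∞) ∧
      (∀ B : Set (StableDensity.Space d), Bornology.IsBounded B →
        Φ ω (⋃ ξ ∈ B, StableDensity.centerTerritory (F ω) ξ) < ∞) := by
  have hFs' : ∀ᵐ ω ∂P, StableDensity.IsStableConstrainedDensity (Ψ ω) (Φ ω)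
      fun x ξ => F ω ξ x := hFs.mono fun _ hf => hf.swap
  filter_upwards [StableDensity.ae_isBounded_centerTerritory hθ hΦ hF.swap hFs',
    StableDensity.ae_isBounded_centerTerritory hθ hΨ hF hFs,
    StableDensity.ae_measure_iUnion_siteTerritory_lt_top hθ hΨ hF hFs,
    StableDensity.ae_measure_iUnion_siteTerritory_lt_top hθ hΦ hF.swap hFs']
    with ω hsite hcenter hsite' hcenter'
  exact ⟨hsite, hcenter, hsite', hcenter'⟩

/-- Boundedness of territories. The unions in the last two clauses run over all points of the
bounded set `B`, as in the definition of stability, hence in particular over those in the support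
of `Φ ω` (the sites), resp. of `Ψ ω` (the centers). -/
theorem theorem3p19 {d : ℕ} {Ω : Type*} [MeasurableSpace Ω]
    (θ : StableDensity.Space d → Ω → Ω) (hθ : StableDensity.IsMeasurableFlow θ)
    (P : Measure Ω) [IsProbabilityMeasure P]
    (Φ Ψ : Ω → Measure (StableDensity.Space d))
    (hΦ : StableDensity.IsStationaryRandomMeasure θ P Φ)
    (hΨ : StableDensity.IsStationaryRandomMeasure θ P Ψ)
    (hΦ0 : ∀ᵐ ω ∂P, Φ ω ≠ 0) (hΨ0 : ∀ᵐ ω ∂P, Ψ ω ≠ 0)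
    (lamΦ lamΨ : ℝ≥0) (hlamΦ : StableDensity.HasIntensity P Φ lamΦ)
    (hlamΨ : StableDensity.HasIntensity P Ψ lamΨ)
    (F : Ω → StableDensity.Space d → StableDensity.Space d → ℝ)
    (hF : StableDensity.IsFlowAdaptedFunction θ F)
    (hFs : ∀ᵐ ω ∂P, StableDensity.IsStableConstrainedDensity (Φ ω) (Ψ ω) (F ω)) :
    ∀ᵐ ω ∂P,
      (∀ᵐ x ∂(Φ ω), Bornology.IsBounded (StableDensity.siteTerritory (F ω) x)) ∧
      (∀ᵐ ξ ∂(Ψ ω), Bornology.IsBounded (StableDensity.centerTerritory (F ω) ξ)) ∧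
      (∀ B : Set (StableDensity.Space d), Bornology.IsBounded B →
        Ψ ω (⋃ x ∈ B, StableDensity.siteTerritory (F ω) x) < ∞) ∧
      (∀ B : Set (StableDensity.Space d), Bornology.IsBounded B →
        Φ ω (⋃ ξ ∈ B, StableDensity.centerTerritory (F ω) ξ) < ∞) :=
  theorem3p19_general hθ hΦ hΨ hF hFs
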